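/- Conventions. A category is semi-abelian when it is pointed (it has a zero object), Barr exact (it is regular, in particular finitely complete, and every internal equivalence relation is a kernel pair), protomodular in the sense of Bourn (for every $v\colon E\to B$ the change-of-base functor $v^*\colon \mathsf{Pt}_B(\mathcal C)\to \mathsf{Pt}_E(\mathcal C)$ reflects isomorphisms) and has binary coproducts. Here $\mathsf{Pt}_B(\mathcal C)$ is the category of points over $B$: its objects are triples $(A,\alpha\colon A\to B,\beta\colon B\to A)$ with $\alpha\beta=1_B$, its morphisms are the morphisms of $\mathcal C$ compatible with the split epimorphisms $\alpha$ and the sections $\beta$. It is a pointed category, and the kernel functor $\mathrm{Ker}_B\colon \mathsf{Pt}_B(\mathcal C)\to\mathcal C$ sends $(A,\alpha,\beta)$ to the kernel of $\alpha$. In a pointed category, a monomorphism is normal when it is the kernel of some morphism, and the normal closure of a monomorphism $x\colon X\to A$ is the smallest normal subobject of $A$ containing $x$. Theorem. Let $\mathcal C$ be a semi-abelian category in which normality is transitive, that is, any composite of two normal monomorphisms is a normal monomorphism. Then: 1. for any object $B$ of $\mathcal C$, the kernel functor $\mathrm{Ker}_B\colon \mathsf{Pt}_B(\mathcal C)\to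 \mathcal C$ preserves normal closures: every monomorphism $x$ in $\mathsf{Pt}_B(\mathcal C)$ has a normal closure $\overline{x}$, and $\mathrm{Ker}_B(\overline{x})$ is the normal closure of $\mathrm{Ker}_B(x)$ in $\mathcal C$; 2. $\mathcal C$ is strongly protomodular: for every object $B$, the functor $\mathrm{Ker}_B$ reflects normal monomorphisms, i.e. a morphism $f$ of $\mathsf{Pt}_B(\mathcal C)$ is a normal monomorphism in $\mathsf{Pt}_B(\mathcal C)$ whenever $\mathrm{Ker}_B(f)$ is a normal monomorphism in $\mathcal C$; 3. $\mathcal C$ satisfies the "Smith is Huq" condition (SH): let $(r_1,r_2)\colon R\rightrightarrows A$ and $(s_1,s_2)\colon S\rightrightarrows A$ be internal equivalence relations on an object $A$, with reflexivity morphisms $\sigma_R,\sigma_S$, and let $n_R\colon N_R\to A$ be the normalisation of $R$, namely the composite of $\ker(r_1)\colon N_R\to R$ with $r_2$; likewise $n_S\colon N_S\to A$. If $N_R$ and $N_S$ Huq-commute, i.e. there is $\varphi\colon N_R\times N_S\to A$ with $\varphi\langle 1,0\rangle=n_R$ and $\varphi\langle 0,1\rangle=n_S$, then $R$ and $S$ Smith-commute,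 i.e. there is a morphism $p\colon R\times_A S\to A$ on the pullback of $r_2$ and $s_1$ such that $p\langle 1_R,\sigma_S r_2\rangle=r_1$ and $p\langle \sigma_R s_1,1_S\rangle=s_2$; 4. $\mathcal C$ satisfies normality of Higgins commutators (NH): for any normal subobjects $k\colon K\to A$ and $l\colon L\to A$ of an object $A$, the Higgins commutator $[K,L]$ is a normal subobject of $A$. Here $[K,L]$ is the regular image, under the morphism $K+L\to A$ induced by $k$ and $l$, of the kernel of the canonical morphism $K+L\to K\times L$ with components $\langle 1_K,0\rangle$ and $\langle 0,1_L\rangle$. -/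

import Mathlib

open CategoryTheory CategoryTheory.Limits

universe v u

noncomputable section

namespace SemiAb

section Points

variable {C : Type u} [Category.{v} C]

/-- A point over `B`: a split epimorphism `proj : pt ⟶ B` with a chosen section `sec`. -/
structure Pt (B : C) where
  pt : C
  proj : pt ⟶ B
  sec : B ⟶ pt
  sec_proj : sec ≫ proj = 𝟙 B

/-- A morphism of points over `B`: it commutes with the split epimorphisms and with the
sections. -/
@[ext]
structure PtHom {B : C} (P Q : Pt B) where
  hom : P.pt ⟶ Q.pt
  hom_proj : hom ≫ Q.proj = P.proj
  sec_hom : P.sec ≫ hom = Q.sec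

/-- The category `Pt_B(C)` of points over `B`. -/
instance (B : C) : Category (Pt B) where
  Hom P Q := PtHom P Q
  id P := ⟨𝟙 P.pt, Category.id_comp _, Category.comp_id _⟩
  comp f g := ⟨f.hom ≫ g.hom, by rw [Category.assoc, g.hom_proj, f.hom_proj],
    by rw [← Category.assoc, f.sec_hom, g.sec_hom]⟩
  id_comp f := PtHom.ext (Category.id_comp f.hom)
  comp_id f := PtHom.ext (Category.comp_id f.hom)
  assoc f g h := PtHom.ext (Category.assoc f.hom g.hom h.hom)

/-- The category `Pt_B(C)` is pointed, with zero object `B = B`; the zero morphism from `P` to `Q`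
is the composite of the split epimorphism of `P` with the section of `Q`. -/
instance (B : C) : HasZeroMorphisms (Pt B) where
  zero P Q := ⟨⟨P.proj ≫ Q.sec, by rw [Category.assoc, Q.sec_proj, Category.comp_id],
    by rw [← Category.assoc, P.sec_proj, Category.id_comp]⟩⟩
  comp_zero {P Q} f R := PtHom.ext
    (show f.hom ≫ Q.proj ≫ R.sec = P.proj ≫ R.sec by rw [← Category.assoc, f.hom_proj])
  zero_comp P {Q R} f := PtHom.ext
    (show (P.proj ≫ Q.sec) ≫ f.hom = P.proj ≫ R.sec by rw [Category.assoc, f.sec_hom])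

/-- The pullback of a point over `B` along `v : E ⟶ B`, a point over `E`. -/
abbrev Pt.pullback [HasPullbacks C] {E B : C} (v : E ⟶ B) (P : Pt B) : Pt E where
  pt := Limits.pullback P.proj v
  proj := pullback.snd P.proj v
  sec := pullback.lift (v ≫ P.sec) (𝟙 E)
    (by rw [Category.assoc, P.sec_proj, Category.comp_id, Category.id_comp])
  sec_proj := pullback.lift_snd _ _ _

/-- The change-of-base functor `v^* : Pt_B(C) ⥤ Pt_E(C)` of the fibration of points, given by
pulling back along `v : E ⟶ B`. -/
abbrev changeOfBase [HasPullbacks C] {E B : C} (v : E ⟶ B) : Pt B ⥤ Pt E where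
  obj P := P.pullback v
  map {P Q} f :=
    { hom := (pullback.lift (pullback.fst P.proj v ≫ f.hom) (pullback.snd P.proj v)
        (by rw [Category.assoc, f.hom_proj, pullback.condition]) :
          Limits.pullback P.proj v ⟶ Limits.pullback Q.proj v)
      hom_proj := pullback.lift_snd _ _ _
      sec_hom := by
        change pullback.lift _ _ _ ≫ pullback.lift _ _ _ = pullback.lift _ _ _
        apply pullback.hom_ext
        · rw [Category.assoc, pullback.lift_fst, ← Category.assoc, pullback.lift_fst,
            pullback.lift_fst, Category.assoc, f.sec_hom]
        · rw [Category.assoc, pullback.lift_snd, pullback.lift_snd, pullback.lift_snd] }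
  map_id P := by
    apply PtHom.ext
    apply pullback.hom_ext
    · exact (pullback.lift_fst _ _ _).trans
        ((Category.comp_id _).trans (Category.id_comp _).symm)
    · exact (pullback.lift_snd _ _ _).trans (Category.id_comp _).symm
  map_comp {P Q R} f g := by
    apply PtHom.ext
    apply pullback.hom_ext
    · refine (pullback.lift_fst _ _ _).trans ?_
      change _ ≫ f.hom ≫ g.hom = (pullback.lift _ _ _ ≫ pullback.lift _ _ _) ≫ _
      rw [Category.assoc, pullback.lift_fst, ← Category.assoc (pullback.lift _ _ _),
        pullback.lift_fst, Category.assoc]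
    · refine (pullback.lift_snd _ _ _).trans ?_
      change _ = (pullback.lift _ _ _ ≫ pullback.lift _ _ _) ≫ _
      rw [Category.assoc, pullback.lift_snd, pullback.lift_snd]

/-- The kernel functor `Ker_B : Pt_B(C) ⥤ C`, sending a point to the kernel of its split
epimorphism. -/
abbrev kerFunctor [HasZeroMorphisms C] [HasKernels C] (B : C) : Pt B ⥤ C where
  obj P := kernel P.proj
  map {P Q} f := kernel.lift Q.proj (kernel.ι P.proj ≫ f.hom)
    (by rw [Category.assoc, f.hom_proj, kernel.condition])
  map_id P := by
    apply equalizer.hom_ext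
    exact (kernel.lift_ι _ _ _).trans ((Category.comp_id _).trans (Category.id_comp _).symm)
  map_comp {P Q R} f g := by
    apply equalizer.hom_ext
    refine (kernel.lift_ι _ _ _).trans ?_
    change _ ≫ f.hom ≫ g.hom = (kernel.lift _ _ _ ≫ kernel.lift _ _ _) ≫ kernel.ι _
    rw [Category.assoc, kernel.lift_ι, ← Category.assoc (kernel.lift _ _ _), kernel.lift_ι,
      Category.assoc]

end Points

section SemiAbelianCategories

variable (C : Type u) [Category.{v} C]

/-- A category is Barr exact when it is regular and every internal equivalence relation in it is
the kernel pair of some morphism. -/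
class BarrExact : Prop extends Regular C where
  isKernelPair_of_isEquivalenceRelation {R A : C} (p₁ p₂ : R ⟶ A) [IsEquivalenceRelation p₁ p₂] :
    ∃ (Q : C) (q : A ⟶ Q), IsKernelPair q p₁ p₂

/-- A category with pullbacks is protomodular (in the sense of Bourn) when all change-of-base
functors of the fibration of points reflect isomorphisms. -/
class Protomodular [HasPullbacks C] : Prop where
  reflectsIsomorphisms {E B : C} (v : E ⟶ B) : (changeOfBase v).ReflectsIsomorphisms

/-- A semi-abelian category: pointed, Barr exact, protomodular, with binary coproducts.
(The zero morphisms are determined by the zero object.) -/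
class SemiAbelian [HasZeroMorphisms C] : Prop extends BarrExact C, Protomodular C where
  hasZeroObject : HasZeroObject C
  hasBinaryCoproducts : HasBinaryCoproducts C

attribute [instance] SemiAbelian.hasZeroObject SemiAbelian.hasBinaryCoproducts

end SemiAbelianCategories

section Normality

variable {C : Type u} [Category.{v} C] [HasZeroMorphisms C]

/-- A morphism is a normal monomorphism when it is the kernel of some morphism. -/
def IsNormalMono {X A : C} (x : X ⟶ A) : Prop :=
  Nonempty (NormalMono x)

/-- `n` is the normal closure of `x`: the smallest normal subobject of `A` containing `x`. -/
structure IsNormalClosure {X N A : C} (x : X ⟶ A) (n : N ⟶ A) : Prop where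
  isNormalMono : IsNormalMono n
  le : ∃ i : X ⟶ N, i ≫ n = x
  minimal : ∀ {K : C} (k : K ⟶ A), IsNormalMono k → (∃ i : X ⟶ K, i ≫ k = x) →
    ∃ j : N ⟶ K, j ≫ k = n

variable (C) in
/-- Normality is transitive: a composite of two normal monomorphisms is a normal monomorphism. -/
def TransitivityOfNormality : Prop :=
  ∀ {X Y Z : C} (f : X ⟶ Y) (g : Y ⟶ Z), IsNormalMono f → IsNormalMono g → IsNormalMono (f ≫ g)

variable (C) in
/-- Every monomorphism of the category has a normal closure. -/
def HasNormalClosures : Prop :=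
  ∀ {X A : C} (x : X ⟶ A) [Mono x], ∃ (N : C) (n : N ⟶ A), IsNormalClosure x n

/-- The functor `F` sends the normal closure of any monomorphism `x` to the normal closure
of `F x`. -/
def PreservesNormalClosures {D : Type*} [Category* D] [HasZeroMorphisms D] (F : D ⥤ C) : Prop :=
  ∀ {X N A : D} (x : X ⟶ A) [Mono x] (n : N ⟶ A),
    IsNormalClosure x n → IsNormalClosure (F.map x) (F.map n)

variable (C) in
/-- Strong protomodularity of a pointed (exact) category: it is protomodular, and each kernel
functor `Ker_B : Pt_B(C) ⥤ C` reflects normal monomorphisms. -/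
class StronglyProtomodular [HasPullbacks C] [HasKernels C] : Prop extends Protomodular C where
  isNormalMono_of_map (B : C) {P Q : Pt B} (f : P ⟶ Q) :
    IsNormalMono ((kerFunctor B).map f) → IsNormalMono f

end Normality

section Commutators

variable {C : Type u} [Category.{v} C]

/-- Two reflexive relations `R`, `S` on `A` Smith-commute: there is a connector
`p : R ×_A S ⟶ A`, i.e. `p (a, b, b) = a` and `p (b, b, c) = c`, where `(a, b, c)` stands for
`((a, b), (b, c))`. -/
def SmithCommute [HasPullbacks C] {R S A : C} {r₁ r₂ : R ⟶ A} {s₁ s₂ : S ⟶ A}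
    (ER : ReflexiveRelation r₁ r₂) (ES : ReflexiveRelation s₁ s₂) : Prop :=
  ∃ p : pullback r₂ s₁ ⟶ A,
    pullback.lift (𝟙 R) (r₂ ≫ ES.r)
      (by rw [Category.id_comp, Category.assoc, ES.reflexivity₁, Category.comp_id]) ≫ p = r₁ ∧
    pullback.lift (s₁ ≫ ER.r) (𝟙 S)
      (by rw [Category.id_comp, Category.assoc, ER.reflexivity₂, Category.comp_id]) ≫ p = s₂

variable [HasZeroMorphisms C]

/-- `x` and `y` Huq-commute: there is a cooperator `φ : X × Y ⟶ A` restricting to `x`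
and to `y`. -/
def HuqCommute [HasBinaryProducts C] {X Y A : C} (x : X ⟶ A) (y : Y ⟶ A) : Prop :=
  ∃ φ : X ⨯ Y ⟶ A, prod.lift (𝟙 X) 0 ≫ φ = x ∧ prod.lift 0 (𝟙 Y) ≫ φ = y

/-- The normalisation `ker r₁ ⟶ R ⟶ A` of a relation `(r₁, r₂)` on `A`. -/
def normalisation [HasKernels C] {R A : C} (r₁ r₂ : R ⟶ A) : kernel r₁ ⟶ A :=
  kernel.ι r₁ ≫ r₂

variable (C) in
/-- The "Smith is Huq" condition (SH): two equivalence relations on the same object Smith-commute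
as soon as their normalisations Huq-commute. -/
def SmithIsHuq [HasPullbacks C] [HasKernels C] [HasBinaryProducts C] : Prop :=
  ∀ {R S A : C} {r₁ r₂ : R ⟶ A} {s₁ s₂ : S ⟶ A}
    (ER : EquivalenceRelation r₁ r₂) (ES : EquivalenceRelation s₁ s₂),
    HuqCommute (normalisation r₁ r₂) (normalisation s₁ s₂) →
      SmithCommute ER.toReflexiveRelation ES.toReflexiveRelation

/-- The canonical morphism `X + Y ⟶ X × Y`, the identity matrix. -/
def coprodToProd [HasBinaryProducts C] [HasBinaryCoproducts C] (X Y : C) : X ⨿ Y ⟶ X ⨯ Y :=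
  coprod.desc (prod.lift (𝟙 X) 0) (prod.lift 0 (𝟙 Y))

/-- The binary cosmash product `X ⋄ Y`, the kernel of `X + Y ⟶ X × Y`. -/
def cosmash [HasBinaryProducts C] [HasBinaryCoproducts C] [HasKernels C] (X Y : C) : C :=
  kernel (coprodToProd X Y)

/-- The Higgins commutator `[X, Y]` of `x : X ⟶ A` and `y : Y ⟶ A`: the image of `X ⋄ Y` under
`⟨x, y⟩ : X + Y ⟶ A`. (In a regular category, this image is the regular image.) -/
def higginsCommutator [HasBinaryProducts C] [HasBinaryCoproducts C] [HasKernels C] [HasImages C]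
    {X Y A : C} (x : X ⟶ A) (y : Y ⟶ A) : Subobject A :=
  imageSubobject ((kernel.ι (coprodToProd X Y) : cosmash X Y ⟶ X ⨿ Y) ≫ coprod.desc x y)

variable (C) in
/-- Normality of Higgins commutators (NH): the Higgins commutator of two normal subobjects is a
normal subobject. -/
def NormalityOfHigginsCommutators [HasBinaryProducts C] [HasBinaryCoproducts C] [HasKernels C]
    [HasImages C] : Prop :=
  ∀ {K L A : C} (k : K ⟶ A) (l : L ⟶ A), IsNormalMono k → IsNormalMono l →
    IsNormalMono (higginsCommutator k l).arrow

end Commutators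

end SemiAb

end

/-! Let (A, p, s) be a point and N a normal subobject of Ker p. Transitivity makes N normal in A, so
N is the kernel of some g : A ⟶ Z. The equalizer of g and its composite with the retraction s∘p is a
normal subpoint, and its kernel is N because s∘p vanishes on Ker p. Thus every normal subobject of
Ker p comes from a normal subpoint (`exists_isNormalMono_kerFunctor`). By protomodularity,
factorisation through a normal subpoint can be tested on kernels
(`IsNormalMono.exists_comp_of_kerFunctor`). The claims on normal closures and strong protomodularity
follow.

For (SH), let K and L be the normalisations of R and S. A cooperator φ identifies K × L with the
inverse image of K along s₁, by (x, y) ↦ (x, φ(x, y)). The diagonal copy of K is the first factor of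
this product, hence normal in the inverse image, which is normal in S. By transitivity it is the
kernel of some q on S (`isNormalMono_comp_diagonal`). Given a R b and b S c, there is a unique d
with a S d and q(a, d) = q(b, c); the connector takes the value d.

For (NH), [K, L] is the image of a normal subobject of K + L, hence normal in the join of K and L
(`IsNormalMono.image`), and that join is normal in A (`IsNormalMono.join`). -/

namespace SemiAb

/-! ### Normal monomorphisms, by generalized elements. -/

section NormalMono

variable {C : Type u} [Category.{v} C] [HasZeroMorphisms C]

/-- A morphism is a normal monomorphism if and only if it is a monomorphism through which exactly
the morphisms annihilated by some fixed morphism factor. -/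
theorem isNormalMono_iff {X A : C} (x : X ⟶ A) :
    IsNormalMono x ↔ Mono x ∧ ∃ (Z : C) (g : A ⟶ Z), x ≫ g = 0 ∧
      ∀ {T : C} (t : T ⟶ A), t ≫ g = 0 → ∃ u : T ⟶ X, u ≫ x = t := by
  constructor
  · rintro ⟨h⟩
    refine ⟨⟨fun a b hab => Fork.IsLimit.hom_ext h.isLimit hab⟩, h.Z, h.g, h.w, fun t ht => ?_⟩
    exact ⟨_, (KernelFork.IsLimit.lift' h.isLimit t ht).2⟩
  · rintro ⟨hm, Z, g, w, h⟩
    refine ⟨⟨Z, g, w, KernelFork.IsLimit.ofι _ _ (fun t ht => (h t ht).choose)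
      (fun t ht => (h t ht).choose_spec) fun t ht m hm' => ?_⟩⟩
    rw [← cancel_mono x, hm', (h t ht).choose_spec]

theorem IsNormalMono.mono {X A : C} {x : X ⟶ A} (h : IsNormalMono x) : Mono x :=
  ((isNormalMono_iff x).1 h).1

theorem IsNormalMono.of_iso {X Y A : C} {x : X ⟶ A} (h : IsNormalMono x) (e : Y ⟶ X) [IsIso e]
    {y : Y ⟶ A} (hy : e ≫ x = y) : IsNormalMono y := by
  subst hy
  obtain ⟨hm, Z, g, w, h⟩ := (isNormalMono_iff x).1 h
  refine (isNormalMono_iff _).2 ⟨inferInstance, Z, g, by simp [w], fun t ht => ?_⟩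
  obtain ⟨u, hu⟩ := h t ht
  exact ⟨u ≫ inv e, by simp [hu]⟩

/-- Monomorphisms that factor through each other are normal together. -/
theorem IsNormalMono.of_factors {X Y A : C} {x : X ⟶ A} (h : IsNormalMono x) {y : Y ⟶ A} [Mono y]
    (i : X ⟶ Y) (hi : i ≫ y = x) (j : Y ⟶ X) (hj : j ≫ x = y) : IsNormalMono y := by
  have := h.mono
  have : IsIso j := ⟨i, by rw [← cancel_mono y, Category.assoc, hi, hj, Category.id_comp],
    by rw [← cancel_mono x, Category.assoc, hj, hi, Category.id_comp]⟩
  exact h.of_iso j hj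

theorem isNormalMono_kernel {A Z : C} (g : A ⟶ Z) [HasKernel g] : IsNormalMono (kernel.ι g) :=
  (isNormalMono_iff _).2 ⟨inferInstance, Z, g, kernel.condition g,
    fun t ht => ⟨kernel.lift g t ht, kernel.lift_ι _ _ _⟩⟩

/-- Normal monomorphisms are stable under pullback. -/
theorem IsNormalMono.pullback_snd {X A A' : C} {x : X ⟶ A} (h : IsNormalMono x) (f : A' ⟶ A)
    [HasPullback x f] : IsNormalMono (pullback.snd x f) := by
  obtain ⟨hm, Z, g, w, h⟩ := (isNormalMono_iff x).1 h
  refine (isNormalMono_iff _).2 ⟨inferInstance, Z, f ≫ g, ?_, fun t ht => ?_⟩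
  · rw [← Category.assoc, ← pullback.condition, Category.assoc, w, comp_zero]
  · obtain ⟨u, hu⟩ := h (t ≫ f) (by rw [Category.assoc, ht])
    exact ⟨pullback.lift u t hu, pullback.lift_snd _ _ _⟩

end NormalMono

/-! ### Split short five lemma and joint extremal epimorphy. -/

section Protomodular

variable {C : Type u} [Category.{v} C]

theorem Pt.isIso_of_isIso_hom {B : C} {P Q : Pt B} (f : P ⟶ Q) [IsIso f.hom] : IsIso f := by
  refine ⟨⟨inv f.hom, ?_, ?_⟩, PtHom.ext ?_, PtHom.ext ?_⟩
  · rw [IsIso.inv_comp_eq, f.hom_proj]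
  · rw [IsIso.comp_inv_eq, f.sec_hom]
  · exact IsIso.hom_inv_id f.hom
  · exact IsIso.inv_hom_id f.hom

theorem Pt.isIso_hom_of_isIso {B : C} {P Q : Pt B} (f : P ⟶ Q) [IsIso f] : IsIso f.hom :=
  ⟨(inv f).hom, congrArg PtHom.hom (IsIso.hom_inv_id f), congrArg PtHom.hom (IsIso.inv_hom_id f)⟩

variable [HasZeroMorphisms C] [HasPullbacks C] [HasZeroObject C] [Protomodular C]

/-- The split short five lemma: a morphism of points which is bijective on the generalized
elements of the kernels is an isomorphism. -/
theorem Pt.isIso_hom_of_kernel {B : C} {P Q : Pt B} (f : P ⟶ Q)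
    (h : ∀ {T : C} (t : T ⟶ Q.pt), t ≫ Q.proj = 0 →
      ∃! u : T ⟶ P.pt, u ≫ P.proj = 0 ∧ u ≫ f.hom = t) : IsIso f.hom := by
  -- Pulling a point back along 0 ⟶ B yields its kernel, so `h` says that this change of base
  -- inverts `f`.
  open ZeroObject in
  let z : (0 : C) ⟶ B := 0
  have hf : ∀ R : Pt B, pullback.fst R.proj z ≫ R.proj = 0 := fun R => by
    rw [pullback.condition]; simp [z]
  obtain ⟨u, ⟨hu₁, hu₂⟩, -⟩ := h (pullback.fst Q.proj z) (hf Q)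
  have : IsIso ((changeOfBase z).map f).hom := by
    refine ⟨pullback.lift u 0 (by simp [hu₁]), ?_, ?_⟩
    · apply pullback.hom_ext
      · obtain ⟨w, -, hw⟩ := h (pullback.fst P.proj z ≫ f.hom)
          (by rw [Category.assoc, f.hom_proj, hf P])
        have h₁ : ((changeOfBase z).map f).hom ≫ pullback.fst Q.proj z =
            pullback.fst P.proj z ≫ f.hom := pullback.lift_fst _ _ _
        refine (hw _ ⟨?_, ?_⟩).trans
          (hw (𝟙 _ ≫ _) ⟨by simpa using hf P, by rw [Category.id_comp]⟩).symm
        · rw [Category.assoc, Category.assoc, pullback.lift_fst_assoc, hu₁, comp_zero]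
        · rw [Category.assoc, Category.assoc, pullback.lift_fst_assoc, hu₂, h₁]
      · exact (isZero_zero C).eq_of_tgt _ _
    · apply pullback.hom_ext
      · rw [Category.assoc, pullback.lift_fst, pullback.lift_fst_assoc, hu₂, Category.id_comp]
      · exact (isZero_zero C).eq_of_tgt _ _
  have := Pt.isIso_of_isIso_hom ((changeOfBase z).map f)
  have := Protomodular.reflectsIsomorphisms z
  have := isIso_of_reflects_iso f (changeOfBase z)
  exact Pt.isIso_hom_of_isIso f

/-- In a pointed protomodular category, the kernel and the section of a split epimorphism are
jointly extremally epimorphic. -/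
theorem isIso_of_mono_of_section_of_kernel {A B M : C} {p : A ⟶ B} {s : B ⟶ A} (hs : s ≫ p = 𝟙 B)
    (m : M ⟶ A) [Mono m] (hsm : ∃ i, i ≫ m = s)
    (hkm : ∀ {T : C} (t : T ⟶ A), t ≫ p = 0 → ∃ i, i ≫ m = t) : IsIso m := by
  obtain ⟨i, hi⟩ := hsm
  let P : Pt B := ⟨M, m ≫ p, i, by rw [← Category.assoc, hi, hs]⟩
  let Q : Pt B := ⟨A, p, s, hs⟩
  let f : P ⟶ Q := ⟨m, rfl, hi⟩
  refine Pt.isIso_hom_of_kernel f fun t ht => ?_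
  obtain ⟨u, hu⟩ := hkm t ht
  refine ⟨u, ⟨?_, hu⟩, fun w hw => ?_⟩
  · change u ≫ m ≫ p = 0
    rw [← Category.assoc, hu]; exact ht
  · rw [← cancel_mono m, hu]; exact hw.2

/-- To factor a morphism out of a split epimorphism through a monomorphism, it suffices to factor
its restrictions to the section and to the kernel. -/
theorem factors_of_section_of_kernel {A B M Z : C} {p : A ⟶ B} {s : B ⟶ A} (hs : s ≫ p = 𝟙 B)
    (m : M ⟶ Z) [Mono m] {f : A ⟶ Z} (hsm : ∃ i, i ≫ m = s ≫ f)
    (hkm : ∀ {T : C} (t : T ⟶ A), t ≫ p = 0 → ∃ i, i ≫ m = t ≫ f) : ∃ i, i ≫ m = f := by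
  have := isIso_of_mono_of_section_of_kernel hs (pullback.snd m f)
    (by obtain ⟨i, hi⟩ := hsm; exact ⟨pullback.lift i s hi, pullback.lift_snd _ _ _⟩)
    fun t ht => by obtain ⟨i, hi⟩ := hkm t ht; exact ⟨pullback.lift i t hi, pullback.lift_snd _ _ _⟩
  exact ⟨inv (pullback.snd m f) ≫ pullback.fst m f, by rw [Category.assoc, pullback.condition,
    IsIso.inv_hom_id_assoc]⟩

theorem hom_ext_of_section_of_kernel [HasEqualizers C] {A B Z : C} {p : A ⟶ B} {s : B ⟶ A}
    (hs : s ≫ p = 𝟙 B) {f g : A ⟶ Z} (hsf : s ≫ f = s ≫ g)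
    (hkf : ∀ {T : C} (t : T ⟶ A), t ≫ p = 0 → t ≫ f = t ≫ g) : f = g := by
  have := isIso_of_mono_of_section_of_kernel hs (equalizer.ι f g)
    ⟨equalizer.lift s hsf, equalizer.lift_ι _ _⟩
    fun t ht => ⟨equalizer.lift t (hkf t ht), equalizer.lift_ι _ _⟩
  exact eq_of_epi_equalizer

end Protomodular

/-! ### The Mal'tsev property. -/

section Relations

variable {C : Type u} [Category.{v} C]

/-- The generalized elements `a` and `b` are related by the relation `(r₁, r₂)`. -/
def Related {R X Y T : C} (r₁ : R ⟶ X) (r₂ : R ⟶ Y) (a : T ⟶ X) (b : T ⟶ Y) : Prop :=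
  ∃ t : T ⟶ R, t ≫ r₁ = a ∧ t ≫ r₂ = b

theorem Related.comp {R X Y T S : C} {r₁ : R ⟶ X} {r₂ : R ⟶ Y} {a : T ⟶ X} {b : T ⟶ Y}
    (h : Related r₁ r₂ a b) (c : S ⟶ T) : Related r₁ r₂ (c ≫ a) (c ≫ b) := by
  obtain ⟨t, rfl, rfl⟩ := h
  exact ⟨c ≫ t, by simp, by simp⟩

theorem mono_prod_lift_of_jointlyMono {R X Y : C} [HasBinaryProduct X Y] {r₁ : R ⟶ X} {r₂ : R ⟶ Y}
    [hR : JointlyMono₂ r₁ r₂] : Mono (prod.lift r₁ r₂) := by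
  refine ⟨fun a b hab => hR.right_cancellation _ _ ?_ ?_⟩
  · rw [← prod.lift_fst r₁ r₂, reassoc_of% hab]
  · rw [← prod.lift_snd r₁ r₂, reassoc_of% hab]

variable [HasZeroMorphisms C] [HasFiniteLimits C] [HasZeroObject C] [Protomodular C]

theorem Related.of_section_of_kernel {R X Y A B : C} {r₁ : R ⟶ X} {r₂ : R ⟶ Y}
    [JointlyMono₂ r₁ r₂] {p : A ⟶ B} {s : B ⟶ A} (hs : s ≫ p = 𝟙 B) {a : A ⟶ X} {b : A ⟶ Y}
    (hsr : Related r₁ r₂ (s ≫ a) (s ≫ b))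
    (hkr : ∀ {T : C} (t : T ⟶ A), t ≫ p = 0 → Related r₁ r₂ (t ≫ a) (t ≫ b)) :
    Related r₁ r₂ a b := by
  have key : ∀ {T : C} (c : T ⟶ X) (d : T ⟶ Y),
      (∃ i, i ≫ prod.lift r₁ r₂ = prod.lift c d) ↔ Related r₁ r₂ c d := fun c d => by
    simp only [prod.comp_lift, Related]
    refine exists_congr fun i => ⟨fun h => ⟨?_, ?_⟩, fun h => by rw [h.1, h.2]⟩
    · rw [← prod.lift_fst c d, ← h, prod.lift_fst]
    · rw [← prod.lift_snd c d, ← h, prod.lift_snd]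
  have : Mono (prod.lift r₁ r₂) := mono_prod_lift_of_jointlyMono
  refine (key a b).1 (factors_of_section_of_kernel hs _ ?_ fun t ht => ?_)
  · rw [prod.comp_lift]; exact (key _ _).2 hsr
  · rw [prod.comp_lift]; exact (key _ _).2 (hkr t ht)

/-- In a pointed protomodular category, every relation is difunctional. -/
theorem Related.difunctional {R X Y : C} {r₁ : R ⟶ X} {r₂ : R ⟶ Y} [hR : JointlyMono₂ r₁ r₂]
    {T : C} {x z : T ⟶ X} {y w : T ⟶ Y} (h₁ : Related r₁ r₂ x y) (h₂ : Related r₁ r₂ z y)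
    (h₃ : Related r₁ r₂ z w) : Related r₁ r₂ x w := by
  -- `D` consists of the pairs (z, y), (z, w) in R, and `E` adds a third pair (x, y). The projection
  -- E ⟶ D is split by x = z, where x R w is clear; on its kernel y = w = 0, so x R w is the given x
  -- R y.
  obtain ⟨D, d₂, d₃, hD⟩ : ∃ (D : C) (d₂ d₃ : D ⟶ R), IsPullback d₂ d₃ r₁ r₁ :=
    ⟨_, _, _, IsPullback.of_hasPullback _ _⟩
  obtain ⟨E, e₁, e, hE⟩ : ∃ (E : C) (e₁ : E ⟶ R) (e : E ⟶ D), IsPullback e₁ e r₂ (d₂ ≫ r₂) :=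
    ⟨_, _, _, IsPullback.of_hasPullback _ _⟩
  have main : Related r₁ r₂ (e₁ ≫ r₁) (e ≫ d₃ ≫ r₂) := by
    refine Related.of_section_of_kernel (hE.lift_snd d₂ (𝟙 D) (by simp)) ⟨d₃, ?_, ?_⟩
      fun t ht => ⟨t ≫ e₁, by simp, ?_⟩
    · rw [hE.lift_fst_assoc, hD.w]
    · rw [hE.lift_snd_assoc, Category.id_comp]
    · rw [Category.assoc, hE.w, reassoc_of% ht, reassoc_of% ht, zero_comp, zero_comp]
  obtain ⟨t₁, rfl, hy⟩ := h₁
  obtain ⟨t₂, rfl, hy'⟩ := h₂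
  obtain ⟨t₃, hz, rfl⟩ := h₃
  convert! main.comp (hE.lift t₁ (hD.lift t₂ t₃ hz.symm) (by simp [hy, hy'])) using 1 <;> simp

/-- A pointed protomodular category is a Mal'tsev category: every internal reflexive relation is an
equivalence relation. -/
theorem isEquivalenceRelation_of_reflexive {R A : C} {r₁ r₂ : R ⟶ A} [hR : JointlyMono₂ r₁ r₂]
    (hr : Related r₁ r₂ (𝟙 A) (𝟙 A)) : IsEquivalenceRelation r₁ r₂ := by
  have refl : ∀ {T : C} (a : T ⟶ A), Related r₁ r₂ a a := fun a => by simpa using hr.comp a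
  have hid : Related r₁ r₂ r₁ r₂ := ⟨𝟙 R, by simp, by simp⟩
  have symm : Related r₁ r₂ r₂ r₁ := Related.difunctional (refl r₂) hid (refl r₁)
  have trans : Related r₁ r₂ (pullback.fst r₂ r₁ ≫ r₁) (pullback.snd r₂ r₁ ≫ r₂) :=
    Related.difunctional (hid.comp _) (refl _) (by
      rw [pullback.condition]; exact hid.comp _)
  obtain ⟨r, hr₁, hr₂⟩ := hr
  obtain ⟨s, hs₁, hs₂⟩ := symm
  obtain ⟨t, ht₁, ht₂⟩ := trans
  exact ⟨⟨{ right_cancellation := hR.right_cancellation, r, reflexivity₁ := hr₁,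
            reflexivity₂ := hr₂, s, symmetry₁ := hs₁, symmetry₂ := hs₂, c := _,
            isLimit := pullbackIsPullback r₂ r₁, t, transitivity₁ := ht₁, transitivity₂ := ht₂ }⟩⟩

end Relations

/-! ### Regular epimorphisms and kernels of split epimorphisms. -/

section Regular

variable {C : Type u} [Category.{v} C]

/-- Factoring through a monomorphism can be checked after composing with a regular epimorphism. -/
theorem factors_of_regularEpi {W X Y Z : C} (e : W ⟶ X) [IsRegularEpi e] (m : Y ⟶ Z) [Mono m]
    {a : X ⟶ Z} (h : ∃ b, b ≫ m = e ≫ a) : ∃ i, i ≫ m = a := by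
  obtain ⟨b, hb⟩ := h
  have sq : CommSq b e m a := ⟨hb⟩
  exact ⟨sq.lift, sq.fac_right⟩

theorem exists_regularEpi_mono_factorisation [Regular C] {X Y : C} (f : X ⟶ Y) :
    ∃ (I : C) (e : X ⟶ I) (m : I ⟶ Y), IsRegularEpi e ∧ Mono m ∧ e ≫ m = f :=
  let F := Regular.strongEpiMonoFactorisation f
  ⟨F.I, F.e, F.m, inferInstance, F.m_mono, F.fac⟩

theorem isRegularEpi_of_isPullback [Regular C] {P X Y Z : C} {a : P ⟶ X} {b : P ⟶ Y} {f : X ⟶ Z}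
    {g : Y ⟶ Z} (h : IsPullback a b f g) [IsRegularEpi g] : IsRegularEpi a :=
  Regular.regularEpiIsStableUnderBaseChange.of_isPullback h.flip ‹_›

variable [HasZeroMorphisms C] [Regular C] [HasZeroObject C] [Protomodular C]

/-- Given a morphism of split epimorphisms over `f : A ⟶ B` whose domain component `g` is a regular
epimorphism, the induced morphism on kernels is surjective: every generalized element of the kernel
of the codomain lifts locally. -/
theorem exists_lift_kernel_of_regularEpi {P A Q B : C} {p : P ⟶ A} {s : A ⟶ P} (hs : s ≫ p = 𝟙 A)
    {p' : Q ⟶ B} {s' : B ⟶ Q} (g : P ⟶ Q) [IsRegularEpi g] (f : A ⟶ B)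
    (hp : p ≫ f = g ≫ p') (hsg : s ≫ g = f ≫ s') {T : C} (t : T ⟶ Q) (ht : t ≫ p' = 0) :
    ∃ (T' : C) (c : T' ⟶ T) (u : T' ⟶ P), IsRegularEpi c ∧ u ≫ p = 0 ∧ u ≫ g = c ≫ t := by
  -- It suffices that P ⟶ A ×_B Q is a regular epimorphism, that is, that its image `m` is
  -- everything; then (0, t) lifts locally.
  obtain ⟨X, x₁, x₂, hX⟩ : ∃ (X : C) (x₁ : X ⟶ A) (x₂ : X ⟶ Q), IsPullback x₁ x₂ f p' :=
    ⟨_, _, _, IsPullback.of_hasPullback _ _⟩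
  obtain ⟨I, e, m, he, hm, hem⟩ := exists_regularEpi_mono_factorisation (hX.lift p g hp)
  obtain ⟨E, ε₁, ε₂, hE⟩ : ∃ (E : C) (ε₁ : E ⟶ X) (ε₂ : E ⟶ P), IsPullback ε₁ ε₂ x₂ g :=
    ⟨_, _, _, IsPullback.of_hasPullback _ _⟩
  have hε : IsRegularEpi ε₁ := isRegularEpi_of_isPullback hE
  -- `E` is split over `P`. An element of the kernel of E ⟶ P is sent to some (a, 0) with f(a) = 0,
  -- which is the image of s(a) because g(s(a)) = s'(f(a)) = 0.
  have h₁ : ∃ i, i ≫ m = ε₁ := by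
    refine factors_of_section_of_kernel (hE.lift_snd (hX.lift p g hp) (𝟙 P) (by simp)) m
      ⟨e, by rw [hem, hE.lift_fst]⟩ fun {S} t ht => ?_
    have h₂ : t ≫ ε₁ ≫ x₂ = 0 := by rw [hE.w, reassoc_of% ht, zero_comp]
    have h₃ : t ≫ ε₁ ≫ x₁ ≫ f = 0 := by rw [hX.w, reassoc_of% h₂, zero_comp]
    refine ⟨t ≫ ε₁ ≫ x₁ ≫ s ≫ e, ?_⟩
    simp only [Category.assoc, hem]
    apply hX.hom_ext
    · simp [hs]
    · simp only [Category.assoc, hX.lift_snd, hsg]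
      rw [reassoc_of% h₃, zero_comp, h₂]
  obtain ⟨j, hj⟩ := factors_of_regularEpi ε₁ m (a := 𝟙 X) (by simpa using h₁)
  obtain ⟨T', c, u, hT'⟩ : ∃ (T' : C) (c : T' ⟶ T) (u : T' ⟶ P),
      IsPullback c u (hX.lift 0 t (by simp [ht]) ≫ j) e := ⟨_, _, _, IsPullback.of_hasPullback _ _⟩
  have hu : u ≫ hX.lift p g hp = c ≫ hX.lift 0 t (by simp [ht]) := by
    rw [← hem, ← Category.assoc, ← hT'.w, Category.assoc, Category.assoc, hj, Category.comp_id]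
  exact ⟨T', c, u, isRegularEpi_of_isPullback hT', by simpa using hu =≫ x₁, by simpa using hu =≫ x₂⟩

end Regular

/-! ### Normal closures, images, joins and Higgins commutators. -/

section Exact

variable {C : Type u} [Category.{v} C] [HasZeroMorphisms C] [BarrExact C] [HasZeroObject C]
  [Protomodular C]

/-- The regular image of a reflexive graph, or of a span which is locally reflexive, is a kernel
pair. -/
theorem exists_isKernelPair_of_reflexive {W A A' : C} (a b : W ⟶ A) (f : A' ⟶ A) [IsRegularEpi f]
    (r : A' ⟶ W) (ha : r ≫ a = f) (hb : r ≫ b = f) :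
    ∃ (R : C) (e : W ⟶ R) (r₁ r₂ : R ⟶ A) (Q : C) (q : A ⟶ Q), IsRegularEpi e ∧ e ≫ r₁ = a ∧
      e ≫ r₂ = b ∧ IsKernelPair q r₁ r₂ := by
  obtain ⟨R, e, m, he, hm, hem⟩ := exists_regularEpi_mono_factorisation (prod.lift a b)
  have h₁ : e ≫ m ≫ prod.fst = a := by rw [reassoc_of% hem, prod.lift_fst]
  have h₂ : e ≫ m ≫ prod.snd = b := by rw [reassoc_of% hem, prod.lift_snd]
  have : JointlyMono₂ (m ≫ prod.fst) (m ≫ prod.snd) := ⟨fun Y c d hc hd => by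
    rw [← cancel_mono m]
    apply prod.hom_ext <;> simpa⟩
  obtain ⟨i, hi⟩ := factors_of_regularEpi f m (a := prod.lift (𝟙 A) (𝟙 A)) ⟨r ≫ e, by
    apply prod.hom_ext
    · rw [Category.assoc, Category.assoc, Category.assoc, h₁, ha, prod.lift_fst,
        Category.comp_id]
    · rw [Category.assoc, Category.assoc, Category.assoc, h₂, hb, prod.lift_snd,
        Category.comp_id]⟩
  have := isEquivalenceRelation_of_reflexive (r₁ := m ≫ prod.fst) (r₂ := m ≫ prod.snd)
    ⟨i, by rw [reassoc_of% hi, prod.lift_fst], by rw [reassoc_of% hi, prod.lift_snd]⟩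
  obtain ⟨Q, q, hq⟩ := BarrExact.isKernelPair_of_isEquivalenceRelation (m ≫ prod.fst)
    (m ≫ prod.snd)
  exact ⟨R, e, _, _, Q, q, he, h₁, h₂, hq⟩

/-- In a semi-abelian category, every morphism has a normal closure. -/
theorem exists_isNormalClosure [HasBinaryCoproducts C] {X A : C} (x : X ⟶ A) :
    ∃ (N : C) (n : N ⟶ A), IsNormalClosure x n := by
  -- This reflexive graph generates the relation identifying `x` with 0; the closure is the kernel
  -- of its quotient `q`.
  obtain ⟨R, e, r₁, r₂, Q, q, he, h₁, h₂, hq⟩ := exists_isKernelPair_of_reflexive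
    (coprod.desc x (𝟙 A)) (coprod.desc 0 (𝟙 A)) (𝟙 A) coprod.inr (coprod.inr_desc _ _)
    (coprod.inr_desc _ _)
  have hx : x ≫ q = 0 := by
    rw [← coprod.inl_desc x (𝟙 A), ← h₁, Category.assoc, Category.assoc, hq.w, reassoc_of% h₂,
      coprod.inl_desc_assoc, zero_comp]
  refine ⟨kernel q, kernel.ι q, isNormalMono_kernel q, ⟨kernel.lift q x hx, kernel.lift_ι _ _ _⟩,
    fun {K} k hk ⟨i, hi⟩ => ?_⟩
  obtain ⟨-, Z, g, w, hg⟩ := (isNormalMono_iff k).1 hk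
  apply hg
  have hr : r₁ ≫ g = r₂ ≫ g := by
    rw [← cancel_epi e, reassoc_of% h₁, reassoc_of% h₂]
    apply coprod.hom_ext <;> simp [← hi, w]
  obtain ⟨u, hu₁, hu₂⟩ : ∃ u, u ≫ r₁ = kernel.ι q ∧ u ≫ r₂ = 0 :=
    ⟨hq.lift (kernel.ι q) 0 (by simp), hq.lift_fst _ _ _, hq.lift_snd _ _ _⟩
  rw [← hu₁, Category.assoc, hr, reassoc_of% hu₂, zero_comp]

/-- The regular image of a normal monomorphism along a regular epimorphism is normal. -/
theorem IsNormalMono.image {K A B I : C} {k : K ⟶ A} (hk : IsNormalMono k) (f : A ⟶ B)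
    [IsRegularEpi f] (e : K ⟶ I) [Epi e] (i : I ⟶ B) [Mono i] (hi : e ≫ i = k ≫ f) :
    IsNormalMono i := by
  obtain ⟨-, Z, g, w, hg⟩ := (isNormalMono_iff k).1 hk
  obtain ⟨W, w₁, w₂, hW⟩ : ∃ (W : C) (w₁ w₂ : W ⟶ A), IsPullback w₁ w₂ g g :=
    ⟨_, _, _, IsPullback.of_hasPullback _ _⟩
  -- The kernel pair of `g` is pushed forward along `f`; by exactness its image is the kernel pair
  -- of some `q`, whose kernel turns out to be `i`.
  obtain ⟨R, c, r₁, r₂, Q, q, hc, h₁, h₂, hq⟩ := exists_isKernelPair_of_reflexive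
    (w₁ ≫ f) (w₂ ≫ f) f (hW.lift (𝟙 A) (𝟙 A) rfl) (by simp) (by simp)
  refine (isNormalMono_iff i).2 ⟨inferInstance, Q, q, ?_, fun {T} t ht => ?_⟩
  · have h₃ : hW.lift k 0 (by simp [w]) ≫ c ≫ r₁ ≫ q = 0 := by
      rw [hq.w, reassoc_of% h₂]; simp
    rw [← cancel_epi e, reassoc_of% hi, comp_zero, ← h₃, reassoc_of% h₁]
    simp
  -- The element (t, 0) of `R` lifts locally to some (a, 0) in `W`, and then a lies in `K`.
  · obtain ⟨T', d, u, hd, hu₁, hu₂⟩ := exists_lift_kernel_of_regularEpi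
      (s' := hq.lift (𝟙 B) (𝟙 B) rfl) (hW.lift_snd (𝟙 A) (𝟙 A) rfl) c f h₂.symm
      (by apply hq.hom_ext <;> simp [h₁, h₂]) (hq.lift t 0 (by simp [ht])) (by simp)
    obtain ⟨u', hu'⟩ := hg (u ≫ w₁) (by rw [Category.assoc, hW.w, reassoc_of% hu₁, zero_comp])
    refine factors_of_regularEpi d i ⟨u' ≫ e, ?_⟩
    rw [Category.assoc, hi, reassoc_of% hu', ← h₁, reassoc_of% hu₂, hq.lift_fst]

/-- The join of two normal subobjects, computed as the regular image of their coproduct, is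
normal. -/
theorem IsNormalMono.join [HasBinaryCoproducts C] {K L A M : C} {k : K ⟶ A} {l : L ⟶ A}
    (hk : IsNormalMono k) (hl : IsNormalMono l) (e : K ⨿ L ⟶ M) [IsRegularEpi e] (m : M ⟶ A)
    [Mono m] (hm : e ≫ m = coprod.desc k l) : IsNormalMono m := by
  obtain ⟨-, Z₀, g₀, w₀, hg₀⟩ := (isNormalMono_iff k).1 hk
  -- With `g` a regular epimorphism, the image `I` of `L` under `g` is normal; the join will be the
  -- inverse image of `I`.
  obtain ⟨Z, g, j, hgr, hj, rfl⟩ := exists_regularEpi_mono_factorisation g₀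
  have w : k ≫ g = 0 := by rw [← cancel_mono j, Category.assoc, w₀, zero_comp]
  obtain ⟨I, d, i, hd, hi, hdi⟩ := exists_regularEpi_mono_factorisation (l ≫ g)
  have hN : IsNormalMono i := hl.image g d i hdi
  have hml : coprod.inr ≫ e ≫ m = l := by rw [hm, coprod.inr_desc]
  have hmk : coprod.inl ≫ e ≫ m = k := by rw [hm, coprod.inl_desc]
  obtain ⟨n, hn⟩ : ∃ n, n ≫ i = m ≫ g := by
    refine factors_of_regularEpi e i ⟨coprod.desc 0 d, ?_⟩
    rw [reassoc_of% hm]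
    apply coprod.hom_ext <;> simp [w, hdi]
  obtain ⟨J, a, b, hJ⟩ : ∃ (J : C) (a : J ⟶ A) (b : J ⟶ L), IsPullback a b g (l ≫ g) :=
    ⟨_, _, _, IsPullback.of_hasPullback _ _⟩
  -- `J` consists of the (a, y) with g(a) = g(y). It is split over `L` with kernel `K`, so its first
  -- projection lands in the join; `J` covers the inverse image of `I` locally.
  obtain ⟨c, hc⟩ : ∃ c, c ≫ m = a := by
    refine factors_of_section_of_kernel (hJ.lift_snd l (𝟙 L) (by simp)) m
      ⟨coprod.inr ≫ e, by simp [hml]⟩ fun t ht => ?_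
    obtain ⟨u, hu⟩ := hg₀ (t ≫ a) (by
      rw [Category.assoc, reassoc_of% hJ.w, reassoc_of% ht, zero_comp])
    exact ⟨u ≫ coprod.inl ≫ e, by rw [Category.assoc, Category.assoc, hmk, hu]⟩
  obtain ⟨T, t, t', hT⟩ : ∃ (T : C) (t : T ⟶ pullback i g) (t' : T ⟶ L),
      IsPullback t t' (pullback.fst i g) d := ⟨_, _, _, IsPullback.of_hasPullback _ _⟩
  have := isRegularEpi_of_isPullback hT
  obtain ⟨v, hv⟩ := factors_of_regularEpi t m (a := pullback.snd i g)
    ⟨hJ.lift (t ≫ pullback.snd i g) t' (by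
      rw [Category.assoc, ← pullback.condition, reassoc_of% hT.w, hdi]) ≫ c, by
      rw [Category.assoc, hc, hJ.lift_fst]⟩
  exact (hN.pullback_snd g).of_factors v hv (pullback.lift n m hn) (pullback.lift_snd _ _ _)

/-- Higgins commutators of normal subobjects are normal as soon as normality is transitive. -/
theorem normalityOfHigginsCommutators [HasBinaryCoproducts C]
    (hToN : TransitivityOfNormality C) : NormalityOfHigginsCommutators C := by
  intro K L A k l hk hl
  obtain ⟨M, e, m, he, hm, hem⟩ := exists_regularEpi_mono_factorisation (coprod.desc k l)
  obtain ⟨I, d, i, hd, hi, hdi⟩ :=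
    exists_regularEpi_mono_factorisation (kernel.ι (coprodToProd K L) ≫ e)
  have h₁ : IsNormalMono (i ≫ m) :=
    hToN i m ((isNormalMono_kernel _).image e d i hdi) (hk.join hl e m hem)
  have := h₁.mono
  have h₂ : d ≫ i ≫ m = kernel.ι (coprodToProd K L) ≫ coprod.desc k l := by
    rw [reassoc_of% hdi, hem]
  let f : cosmash K L ⟶ A := kernel.ι (coprodToProd K L) ≫ coprod.desc k l
  change IsNormalMono (imageSubobject f).arrow
  obtain ⟨a, ha⟩ := factors_of_regularEpi d (imageSubobject f).arrow (a := i ≫ m)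
    ⟨factorThruImageSubobject f, (imageSubobject_arrow_comp f).trans h₂.symm⟩
  obtain ⟨b, hb⟩ : ∃ b, b ≫ i ≫ m = (imageSubobject f).arrow :=
    ⟨Subobject.ofLEMk _ (i ≫ m) (imageSubobject_le_mk _ _ d h₂), Subobject.ofLEMk_comp _⟩
  exact h₁.of_factors a ha b hb

end Exact

/-! ### Smith is Huq. -/

section SmithIsHuq

variable {C : Type u} [Category.{v} C] [HasZeroMorphisms C]

section Normalisation

variable [HasKernels C] {R A Q : C} {r₁ r₂ : R ⟶ A} {f : A ⟶ Q}

theorem normalisation_comp (h : IsKernelPair f r₁ r₂) : normalisation r₁ r₂ ≫ f = 0 := by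
  rw [normalisation, Category.assoc, ← h.w, kernel.condition_assoc, zero_comp]

theorem exists_comp_normalisation (h : IsKernelPair f r₁ r₂) {T : C} (t : T ⟶ A)
    (ht : t ≫ f = 0) : ∃ u, u ≫ normalisation r₁ r₂ = t := by
  refine ⟨kernel.lift r₁ (h.lift 0 t (by simp [ht])) (by simp), ?_⟩
  rw [normalisation, kernel.lift_ι_assoc, h.lift_snd]

theorem mono_normalisation (h : IsKernelPair f r₁ r₂) : Mono (normalisation r₁ r₂) := by
  refine ⟨fun a b hab => ?_⟩
  rw [← cancel_mono (kernel.ι r₁)]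
  apply h.hom_ext
  · simp
  · simpa [normalisation] using hab

/-- The normalisation of the kernel pair of `f` is the kernel of `f`. -/
theorem isNormalMono_normalisation (h : IsKernelPair f r₁ r₂) :
    IsNormalMono (normalisation r₁ r₂) :=
  (isNormalMono_iff _).2 ⟨mono_normalisation h, Q, f, normalisation_comp h,
    exists_comp_normalisation h⟩

end Normalisation

variable [HasFiniteLimits C] [HasZeroObject C] [Protomodular C]

/-- If normality is transitive and the normal subobject `k` Huq-commutes with the kernel of `g`,
then the diagonal embedding of `k` into the kernel pair of `g` is normal. -/
theorem isNormalMono_comp_diagonal (hToN : TransitivityOfNormality C) {K A S Q : C} {k : K ⟶ A}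
    (hk : IsNormalMono k) {s₁ s₂ : S ⟶ A} {g : A ⟶ Q} (hS : IsKernelPair g s₁ s₂)
    (hkl : HuqCommute k (normalisation s₁ s₂)) (σ : A ⟶ S) (h₁ : σ ≫ s₁ = 𝟙 A)
    (h₂ : σ ≫ s₂ = 𝟙 A) : IsNormalMono (k ≫ σ) := by
  obtain ⟨φ, hφ₁, hφ₂⟩ := hkl
  have hl := mono_normalisation hS
  have hlg := normalisation_comp hS
  have hS' := @exists_comp_normalisation _ _ _ _ _ _ _ _ _ _ hS
  revert φ
  generalize normalisation s₁ s₂ = l at hl hlg hS'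
  generalize kernel s₁ = L at l
  intro φ hφ₁ hφ₂
  obtain ⟨J, a, b, hJ, hb⟩ : ∃ (J : C) (a : J ⟶ K) (b : J ⟶ S), IsPullback a b k s₁ ∧
      IsNormalMono b := ⟨_, _, _, IsPullback.of_hasPullback _ _, hk.pullback_snd s₁⟩
  have hs : prod.lift (𝟙 K) (0 : K ⟶ L) ≫ prod.fst = 𝟙 K := prod.lift_fst _ _
  have hz : ∀ {T : C} (t : T ⟶ K ⨯ L), t ≫ prod.fst = 0 →
      t = (t ≫ prod.snd) ≫ prod.lift 0 (𝟙 L) := fun t ht => by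
    apply prod.hom_ext
    · rw [ht, Category.assoc, prod.lift_fst, comp_zero]
    · rw [Category.assoc, prod.lift_snd, Category.comp_id]
  have hz' : ∀ {T : C} (t : T ⟶ K ⨯ L), t ≫ prod.fst = 0 → t ≫ φ = (t ≫ prod.snd) ≫ l :=
    fun t ht => by rw [hz t ht, Category.assoc, hφ₂, ← hz t ht]
  have hφ : (prod.fst ≫ k) ≫ g = φ ≫ g := by
    refine hom_ext_of_section_of_kernel hs ?_ fun t ht => ?_
    · rw [← Category.assoc, ← Category.assoc, hs, reassoc_of% hφ₁, Category.id_comp]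
    · rw [Category.assoc, reassoc_of% ht, reassoc_of% hz' t ht, hlg]
      simp
  -- `ψ` is a morphism of points over `K`, both with kernel `L`, hence an isomorphism; it carries
  -- ⟨1, 0⟩ to the diagonal of `K`.
  let ψ : K ⨯ L ⟶ J := hJ.lift prod.fst (hS.lift (prod.fst ≫ k) φ hφ) (by simp)
  have hψa : ψ ≫ a = prod.fst := hJ.lift_fst _ _ _
  have hψb : ψ ≫ b ≫ s₂ = φ := by
    rw [← Category.assoc, hJ.lift_snd, hS.lift_snd]
  have hsψ : prod.lift (𝟙 K) 0 ≫ ψ = hJ.lift (𝟙 K) (k ≫ σ) (by simp [h₁]) := by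
    apply hJ.hom_ext
    · rw [Category.assoc, hψa, hs, hJ.lift_fst]
    · apply hS.hom_ext
      · rw [Category.assoc, Category.assoc, ← hJ.w, reassoc_of% hψa, reassoc_of% hs, hJ.lift_snd,
          Category.assoc, h₁, Category.comp_id]
      · rw [Category.assoc, Category.assoc, hψb, hφ₁, hJ.lift_snd, Category.assoc, h₂,
          Category.comp_id]
  have hψ : IsIso ψ := by
    let P : Pt K := ⟨K ⨯ L, prod.fst, prod.lift (𝟙 K) 0, hs⟩
    let P' : Pt K := ⟨J, a, hJ.lift (𝟙 K) (k ≫ σ) (by simp [h₁]), hJ.lift_fst _ _ _⟩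
    let F : P ⟶ P' := ⟨ψ, hψa, hsψ⟩
    refine Pt.isIso_hom_of_kernel F fun {T} (t : T ⟶ J) (ht : t ≫ a = 0) => ?_
    have ht₁ : t ≫ b ≫ s₁ = 0 := by rw [← hJ.w, reassoc_of% ht, zero_comp]
    obtain ⟨w, hw⟩ := hS' (t ≫ b ≫ s₂) (by
      rw [Category.assoc, Category.assoc, ← hS.w, reassoc_of% ht₁, zero_comp])
    refine ⟨prod.lift 0 w, ⟨prod.lift_fst _ _, ?_⟩, fun c ⟨hc₁, hc₂⟩ => ?_⟩
    · change prod.lift 0 w ≫ ψ = t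
      apply hJ.hom_ext
      · rw [Category.assoc, hψa, prod.lift_fst, ht]
      · apply hS.hom_ext
        · rw [Category.assoc, Category.assoc, Category.assoc, ht₁, ← hJ.w, reassoc_of% hψa,
            prod.lift_fst_assoc, zero_comp]
        · rw [Category.assoc, Category.assoc, Category.assoc, hψb, hz' _ (prod.lift_fst _ _),
            prod.lift_snd, hw]
    · change c ≫ prod.fst = 0 at hc₁
      change c ≫ ψ = t at hc₂
      apply prod.hom_ext
      · rw [hc₁, prod.lift_fst]
      · rw [prod.lift_snd, ← cancel_mono l, hw, ← hz' c hc₁, ← hc₂, Category.assoc, hψb]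
  have hx : IsNormalMono (hJ.lift (𝟙 K) (k ≫ σ) (by simp [h₁])) := by
    refine (isNormalMono_iff _).2 ⟨?_, L, inv ψ ≫ prod.snd, ?_, fun t ht => ?_⟩
    · exact mono_of_mono_fac (hJ.lift_fst _ _ _)
    · rw [← hsψ, Category.assoc, IsIso.hom_inv_id_assoc, prod.lift_snd]
    · refine ⟨t ≫ inv ψ ≫ prod.fst, ?_⟩
      rw [← hsψ, ← Category.assoc, ← IsIso.eq_comp_inv]
      apply prod.hom_ext
      · rw [Category.assoc, hs, Category.comp_id, Category.assoc]
      · rw [Category.assoc, prod.lift_snd, comp_zero, Category.assoc, ht]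
  have := hToN _ _ hx hb
  rwa [hJ.lift_snd] at this

/-- The "Smith is Huq" condition holds as soon as normality is transitive. -/
theorem smithIsHuq {C : Type u} [Category.{v} C] [HasZeroMorphisms C] [BarrExact C]
    [HasZeroObject C] [Protomodular C] (hToN : TransitivityOfNormality C) : SmithIsHuq C := by
  intro R S A r₁ r₂ s₁ s₂ ER ES hRS
  have := ER.isEquivalenceRelation
  have := ES.isEquivalenceRelation
  obtain ⟨Q, f, hf⟩ := BarrExact.isKernelPair_of_isEquivalenceRelation r₁ r₂
  obtain ⟨Q', g, hg⟩ := BarrExact.isKernelPair_of_isEquivalenceRelation s₁ s₂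
  have hN := isNormalMono_comp_diagonal hToN (isNormalMono_normalisation hf) hg hRS ES.r
    ES.reflexivity₁ ES.reflexivity₂
  have hk := mono_normalisation hf
  have hkf := normalisation_comp hf
  have hf' := @exists_comp_normalisation _ _ _ _ _ _ _ _ _ _ hf
  generalize normalisation r₁ r₂ = k at hN hk hkf hf'
  obtain ⟨-, Z, q, hq₀, hq⟩ := (isNormalMono_iff _).1 hN
  obtain ⟨W, w₁, w₂, hW⟩ : ∃ (W : C) (w₁ w₂ : W ⟶ S), IsPullback w₁ w₂ q q :=
    ⟨_, _, _, IsPullback.of_hasPullback _ _⟩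
  have hX := IsPullback.of_hasPullback r₂ s₁
  have hw : (w₁ ≫ s₁) ≫ f = (w₂ ≫ s₁) ≫ f := by
    refine hom_ext_of_section_of_kernel (hW.lift_snd (𝟙 S) (𝟙 S) rfl) (by simp) fun t ht => ?_
    obtain ⟨u, hu⟩ := hq (t ≫ w₁) (by rw [Category.assoc, hW.w, reassoc_of% ht, zero_comp])
    simp only [Category.assoc]
    rw [reassoc_of% ht, ← reassoc_of% hu, ES.reflexivity₁_assoc, hkf]
    simp
  obtain ⟨ρ, hρ₁, hρ₂⟩ : ∃ ρ, ρ ≫ r₁ = w₁ ≫ s₁ ∧ ρ ≫ r₂ = w₂ ≫ s₁ :=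
    ⟨hf.lift _ _ hw, hf.lift_fst _ _ _, hf.lift_snd _ _ _⟩
  let P : Pt S := ⟨W, w₂, hW.lift (𝟙 S) (𝟙 S) rfl, hW.lift_snd _ _ _⟩
  let P' : Pt S := ⟨pullback r₂ s₁, pullback.snd r₂ s₁, pullback.lift (s₁ ≫ ER.r) (𝟙 S)
    (by simp), pullback.lift_snd _ _ _⟩
  -- `θ` sends a pair ((a, d), (b, c)) identified by `q` to (a, b, c). Over `S`, both sides have
  -- kernel `K`, so it is invertible, and d becomes a function of (a, b, c).
  obtain ⟨θ, hθ₁, hθ₂⟩ : ∃ θ : W ⟶ pullback r₂ s₁, θ ≫ pullback.fst r₂ s₁ = ρ ∧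
      θ ≫ pullback.snd r₂ s₁ = w₂ := ⟨hX.lift ρ w₂ hρ₂, hX.lift_fst _ _ _, hX.lift_snd _ _ _⟩
  have hθs : hW.lift (𝟙 S) (𝟙 S) rfl ≫ θ = pullback.lift (s₁ ≫ ER.r) (𝟙 S) (by simp) := by
    apply pullback.hom_ext
    · rw [Category.assoc, hθ₁, pullback.lift_fst]
      apply hf.hom_ext
      · rw [Category.assoc, hρ₁, hW.lift_fst_assoc, Category.assoc, ER.reflexivity₁]
        simp
      · rw [Category.assoc, hρ₂, hW.lift_snd_assoc, Category.assoc, ER.reflexivity₂]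
        simp
    · rw [Category.assoc, hθ₂, pullback.lift_snd, hW.lift_snd]
  have hθ : IsIso θ := by
    let F : P ⟶ P' := ⟨θ, hθ₂, hθs⟩
    refine Pt.isIso_hom_of_kernel F fun {T} (t : T ⟶ pullback r₂ s₁)
      (ht : t ≫ pullback.snd r₂ s₁ = 0) => ?_
    have ht₁ : t ≫ pullback.fst r₂ s₁ ≫ r₂ = 0 := by
      rw [pullback.condition, reassoc_of% ht, zero_comp]
    obtain ⟨w, hw⟩ := hf' (t ≫ pullback.fst r₂ s₁ ≫ r₁) (by
      rw [Category.assoc, Category.assoc, hf.w, reassoc_of% ht₁, zero_comp])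
    refine ⟨hW.lift (w ≫ k ≫ ES.r) 0 (by simpa using w ≫= hq₀), ⟨hW.lift_snd _ _ _, ?_⟩,
      fun c ⟨hc₁, hc₂⟩ => ?_⟩
    · change hW.lift _ _ _ ≫ θ = t
      apply pullback.hom_ext
      · rw [Category.assoc, hθ₁]
        apply hf.hom_ext
        · rw [Category.assoc, hρ₁, hW.lift_fst_assoc, Category.assoc, Category.assoc,
            ES.reflexivity₁, Category.comp_id, hw, Category.assoc]
        · rw [Category.assoc, hρ₂, hW.lift_snd_assoc, zero_comp, Category.assoc, ht₁]
      · rw [Category.assoc, hθ₂, hW.lift_snd, ht]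
    · change c ≫ w₂ = 0 at hc₁
      change c ≫ θ = t at hc₂
      obtain ⟨x, hx⟩ := hq (c ≫ w₁) (by rw [Category.assoc, hW.w, reassoc_of% hc₁, zero_comp])
      have hxw : x = w := by
        rw [← cancel_mono k, hw, ← hc₂, Category.assoc, reassoc_of% hθ₁, hρ₁, ← reassoc_of% hx,
          ES.reflexivity₁, Category.comp_id]
      apply hW.hom_ext
      · rw [hW.lift_fst, ← hx, hxw]
      · rw [hc₁, hW.lift_snd]
  -- Since `q` kills the diagonal of `K`, it identifies (a, a) with (b, b) whenever a R b. This
  -- yields p(a, b, b) = a.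
  have hσ : (r₁ ≫ ES.r) ≫ q = (r₂ ≫ ES.r) ≫ q := by
    refine hom_ext_of_section_of_kernel ER.reflexivity₁ (by simp) fun t ht => ?_
    obtain ⟨u, hu⟩ := hf' (t ≫ r₂) (by rw [Category.assoc, ← hf.w, reassoc_of% ht, zero_comp])
    rw [Category.assoc, Category.assoc, reassoc_of% ht, ← reassoc_of% hu, ← Category.assoc k, hq₀]
    simp
  refine ⟨inv θ ≫ w₁ ≫ s₂, ?_, ?_⟩
  · have : pullback.lift (𝟙 R) (r₂ ≫ ES.r) (by simp) = hW.lift (r₁ ≫ ES.r) (r₂ ≫ ES.r) hσ ≫ θ := by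
      apply pullback.hom_ext
      · rw [pullback.lift_fst, Category.assoc, hθ₁]
        apply hf.hom_ext
        · rw [Category.assoc, hρ₁, hW.lift_fst_assoc, Category.assoc, ES.reflexivity₁]
          simp
        · rw [Category.assoc, hρ₂, hW.lift_snd_assoc, Category.assoc, ES.reflexivity₁]
          simp
      · rw [pullback.lift_snd, Category.assoc, hθ₂, hW.lift_snd]
    rw [this, Category.assoc, IsIso.hom_inv_id_assoc, hW.lift_fst_assoc, Category.assoc,
      ES.reflexivity₂, Category.comp_id]
  · rw [← hθs, Category.assoc, IsIso.hom_inv_id_assoc, hW.lift_fst_assoc, Category.id_comp]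

end SmithIsHuq

/-! ### Normal subpoints and the kernel functor. -/

section KernelFunctor

variable {C : Type u} [Category.{v} C]

/-- The subpoint of `Q` on which `g` agrees with its composite with the retraction of `Q` onto the
base. -/
noncomputable def Pt.kernelPoint [HasEqualizers C] {B Z : C} (Q : Pt B) (g : Q.pt ⟶ Z) : Pt B where
  pt := equalizer g (Q.proj ≫ Q.sec ≫ g)
  proj := equalizer.ι _ _ ≫ Q.proj
  sec := equalizer.lift Q.sec (by rw [← Category.assoc Q.sec, Q.sec_proj, Category.id_comp])
  sec_proj := by rw [equalizer.lift_ι_assoc, Q.sec_proj]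

/-- The inclusion of `Q.kernelPoint g` into `Q`. -/
noncomputable def Pt.kernelPointι [HasEqualizers C] {B Z : C} (Q : Pt B) (g : Q.pt ⟶ Z) :
    Q.kernelPoint g ⟶ Q where
  hom := equalizer.ι g (Q.proj ≫ Q.sec ≫ g)
  hom_proj := rfl
  sec_hom := equalizer.lift_ι _ _

section

variable [HasEqualizers C] {B Z : C} (Q : Pt B) (g : Q.pt ⟶ Z)

theorem Pt.kernelPointι_condition :
    (Q.kernelPointι g).hom ≫ g = (Q.kernelPointι g).hom ≫ Q.proj ≫ Q.sec ≫ g :=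
  equalizer.condition g (Q.proj ≫ Q.sec ≫ g)

instance : Mono (Q.kernelPointι g).hom :=
  inferInstanceAs (Mono (equalizer.ι g (Q.proj ≫ Q.sec ≫ g)))

theorem Pt.exists_comp_kernelPointι_hom {T : C} (t : T ⟶ Q.pt)
    (ht : t ≫ g = t ≫ Q.proj ≫ Q.sec ≫ g) : ∃ u, u ≫ (Q.kernelPointι g).hom = t :=
  ⟨equalizer.lift t ht, equalizer.lift_ι _ _⟩

theorem Pt.exists_comp_kernelPointι {P : Pt B} (f : P ⟶ Q)
    (hf : f.hom ≫ g = P.proj ≫ Q.sec ≫ g) : ∃ i, i ≫ Q.kernelPointι g = f := by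
  obtain ⟨u, hu⟩ := Q.exists_comp_kernelPointι_hom g f.hom
    (by rw [hf, ← f.hom_proj, Category.assoc])
  refine ⟨⟨u, ?_, ?_⟩, PtHom.ext hu⟩
  · rw [← f.hom_proj, ← hu, Category.assoc, (Q.kernelPointι g).hom_proj]
  · rw [← cancel_mono (Q.kernelPointι g).hom, Category.assoc, hu, f.sec_hom,
      (Q.kernelPointι g).sec_hom]

theorem Pt.isNormalMono_kernelPointι [HasBinaryProducts C] : IsNormalMono (Q.kernelPointι g) := by
  -- `g` itself is not a morphism of points; pairing it with `Q.proj` makes it one, into B × Z with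
  -- section ⟨1, g∘s⟩.
  let Q' : Pt B := ⟨B ⨯ Z, prod.fst, prod.lift (𝟙 B) (Q.sec ≫ g), prod.lift_fst _ _⟩
  let h : Q ⟶ Q' := ⟨prod.lift Q.proj g, prod.lift_fst _ _, by
    rw [prod.comp_lift, Q.sec_proj]⟩
  refine (isNormalMono_iff _).2 ⟨⟨fun a b hab => PtHom.ext ?_⟩, Q', h, PtHom.ext ?_,
    fun {P} t ht => Q.exists_comp_kernelPointι g t ?_⟩
  · rw [← cancel_mono (Q.kernelPointι g).hom]
    exact congrArg PtHom.hom hab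
  · change (Q.kernelPointι g).hom ≫ prod.lift Q.proj g =
      (Q.kernelPoint g).proj ≫ prod.lift (𝟙 B) (Q.sec ≫ g)
    rw [prod.comp_lift, prod.comp_lift, Q.kernelPointι_condition, ← (Q.kernelPointι g).hom_proj]
    simp
  · have h' : t.hom ≫ prod.lift Q.proj g = P.proj ≫ prod.lift (𝟙 B) (Q.sec ≫ g) :=
      congrArg PtHom.hom ht
    have := h' =≫ prod.snd
    rwa [Category.assoc, Category.assoc, prod.lift_snd, prod.lift_snd] at this

end

variable [HasZeroMorphisms C]

theorem kerFunctor_map_ι [HasKernels C] {B : C} {P Q : Pt B} (f : P ⟶ Q) :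
    (kerFunctor B).map f ≫ kernel.ι Q.proj = kernel.ι P.proj ≫ f.hom :=
  kernel.lift_ι _ _ _

/-- A normal monomorphism of points is, as a morphism of the underlying category, a monomorphism
whose restriction to the kernels is the kernel of some morphism out of `Q`. -/
theorem IsNormalMono.exists_hom [HasEqualizers C] {B : C} {K Q : Pt B} {k : K ⟶ Q}
    (hk : IsNormalMono k) : Mono k.hom ∧ ∃ (Q' : Pt B) (h : Q ⟶ Q'), k ≫ h = 0 ∧
      (∀ {P : Pt B} (f : P ⟶ Q), f ≫ h = 0 → ∃ i, i ≫ k = f) ∧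
      ∀ {T : C} (t : T ⟶ Q.pt), t ≫ Q.proj = 0 → t ≫ h.hom = 0 → ∃ u, u ≫ k.hom = t := by
  obtain ⟨hm, Q', h, w, hl⟩ := (isNormalMono_iff k).1 hk
  have w' : k.hom ≫ h.hom = K.proj ≫ Q'.sec := congrArg PtHom.hom w
  -- The kernel of `h` in points is an equalizer computed in `C`, so `k` agrees with it up to
  -- isomorphism.
  obtain ⟨i, hi⟩ := Q.exists_comp_kernelPointι h.hom k (by rw [w', h.sec_hom])
  obtain ⟨j, hj⟩ := hl (Q.kernelPointι h.hom) (PtHom.ext (by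
    change (Q.kernelPointι h.hom).hom ≫ h.hom = (Q.kernelPoint h.hom).proj ≫ Q'.sec
    rw [Q.kernelPointι_condition, h.sec_hom, ← Category.assoc, (Q.kernelPointι h.hom).hom_proj]))
  have hij : i ≫ j = 𝟙 K := by rw [← cancel_mono k, Category.assoc, hj, hi, Category.id_comp]
  have hij' : i.hom ≫ j.hom = 𝟙 K.pt := congrArg PtHom.hom hij
  have : Mono i.hom := mono_of_mono_fac hij'
  have hi' : i.hom ≫ (Q.kernelPointι h.hom).hom = k.hom := congrArg PtHom.hom hi
  refine ⟨hi' ▸ mono_comp _ _, Q', h, w, hl, fun t ht ht' => ?_⟩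
  obtain ⟨u, hu⟩ := Q.exists_comp_kernelPointι_hom h.hom t (by
    rw [ht', reassoc_of% ht, zero_comp])
  have hj' : j.hom ≫ k.hom = (Q.kernelPointι h.hom).hom := congrArg PtHom.hom hj
  exact ⟨u ≫ j.hom, by rw [Category.assoc, hj', hu]⟩

/-- The kernel functor preserves normal monomorphisms. -/
theorem IsNormalMono.kerFunctor_map [HasKernels C] [HasEqualizers C] {B : C} {K Q : Pt B}
    {k : K ⟶ Q} (hk : IsNormalMono k) : IsNormalMono ((kerFunctor B).map k) := by
  obtain ⟨hm, Q', h, w, -, hl⟩ := hk.exists_hom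
  have w' : k.hom ≫ h.hom = K.proj ≫ Q'.sec := congrArg PtHom.hom w
  have hk' := kerFunctor_map_ι k
  refine (isNormalMono_iff _).2 ⟨?_, Q'.pt, kernel.ι Q.proj ≫ h.hom, ?_, fun t ht => ?_⟩
  · exact mono_of_mono_fac hk'
  · rw [← Category.assoc, hk', Category.assoc, w', kernel.condition_assoc, zero_comp]
  · obtain ⟨u, hu⟩ := hl (t ≫ kernel.ι Q.proj) (by simp) (by rw [Category.assoc, ht])
    refine ⟨kernel.lift K.proj u (by rw [← k.hom_proj, reassoc_of% hu]; simp), ?_⟩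
    rw [← cancel_mono (kernel.ι Q.proj), Category.assoc, hk', kernel.lift_ι_assoc, hu]

variable [HasFiniteLimits C]

/-- If normality is transitive, then every normal subobject of the kernel of a point is the kernel
of a normal subpoint. -/
theorem exists_isNormalMono_kerFunctor (hToN : TransitivityOfNormality C) {B N : C} {Q : Pt B}
    (n : N ⟶ kernel Q.proj) (hn : IsNormalMono n) :
    ∃ (M : Pt B) (m : M ⟶ Q), IsNormalMono m ∧ (∃ i, i ≫ (kerFunctor B).map m = n) ∧
      ∃ j, j ≫ n = (kerFunctor B).map m := by
  obtain ⟨-, Z, g, w, hg⟩ := (isNormalMono_iff _).1 (hToN n _ hn (isNormalMono_kernel Q.proj))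
  refine ⟨Q.kernelPoint g, Q.kernelPointι g, Q.isNormalMono_kernelPointι g, ?_, ?_⟩
  · obtain ⟨u, hu⟩ := Q.exists_comp_kernelPointι_hom g (n ≫ kernel.ι Q.proj) (by
      rw [w]; simp)
    refine ⟨kernel.lift _ u ?_, ?_⟩
    · rw [← (Q.kernelPointι g).hom_proj, reassoc_of% hu]; simp
    · rw [← cancel_mono (kernel.ι Q.proj), Category.assoc, kerFunctor_map_ι, kernel.lift_ι_assoc,
        hu]
  · obtain ⟨j, hj⟩ := hg ((kerFunctor B).map (Q.kernelPointι g) ≫ kernel.ι Q.proj) (by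
      rw [kerFunctor_map_ι, Category.assoc, Q.kernelPointι_condition,
        ← Category.assoc (Q.kernelPointι g).hom, (Q.kernelPointι g).hom_proj,
        kernel.condition_assoc, zero_comp])
    exact ⟨j, by rw [← cancel_mono (kernel.ι Q.proj), Category.assoc, hj]⟩

variable [HasZeroObject C] [Protomodular C]

/-- The kernel functor reflects the factorisation of morphisms through normal monomorphisms. -/
theorem IsNormalMono.exists_comp_of_kerFunctor {B : C} {P K Q : Pt B} {k : K ⟶ Q}
    (hk : IsNormalMono k) (f : P ⟶ Q)
    (h : ∃ i, i ≫ (kerFunctor B).map k = (kerFunctor B).map f) : ∃ i, i ≫ k = f := by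
  obtain ⟨-, Q', g, w, hl, -⟩ := hk.exists_hom
  have w' : k.hom ≫ g.hom = K.proj ≫ Q'.sec := congrArg PtHom.hom w
  obtain ⟨i, hi⟩ := h
  refine hl f (PtHom.ext ?_)
  change f.hom ≫ g.hom = P.proj ≫ Q'.sec
  -- On the section both sides are `Q'.sec`; on the kernel both vanish, as `f` factors through `k`
  -- there.
  refine hom_ext_of_section_of_kernel P.sec_proj ?_ fun t ht => ?_
  · rw [← Category.assoc, f.sec_hom, g.sec_hom, ← Category.assoc, P.sec_proj, Category.id_comp]
  · rw [reassoc_of% ht, zero_comp, ← kernel.lift_ι P.proj t ht, Category.assoc,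
      ← Category.assoc (kernel.ι P.proj), ← kerFunctor_map_ι f, ← hi, Category.assoc,
      Category.assoc, ← Category.assoc ((kerFunctor B).map k), kerFunctor_map_ι k, Category.assoc,
      w', kernel.condition_assoc, zero_comp, comp_zero, comp_zero]

/-- A normal subobject containing Ker(x) lifts to a normal subpoint, which contains x and hence its
closure. -/
theorem kerFunctor_preservesNormalClosures (hToN : TransitivityOfNormality C) (B : C) :
    PreservesNormalClosures (kerFunctor B) := by
  intro P N Q x _ n hn
  refine ⟨hn.isNormalMono.kerFunctor_map, ?_, fun {K} k hk hxk => ?_⟩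
  · obtain ⟨i, hi⟩ := hn.le
    exact ⟨(kerFunctor B).map i, by rw [← Functor.map_comp, hi]⟩
  · obtain ⟨M, m, hm, ⟨i, hi⟩, j, hj⟩ := exists_isNormalMono_kerFunctor hToN k hk
    obtain ⟨a, ha⟩ := hxk
    obtain ⟨b, hb⟩ := hn.minimal m hm
      (hm.exists_comp_of_kerFunctor x ⟨a ≫ i, by rw [Category.assoc, hi, ha]⟩)
    exact ⟨(kerFunctor B).map b ≫ j, by rw [Category.assoc, hj, ← Functor.map_comp, hb]⟩

/-- The closure is the normal subpoint lifting the normal closure of Ker(x) taken in `C`. -/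
theorem hasNormalClosures_pt {C : Type u} [Category.{v} C] [HasZeroMorphisms C] [BarrExact C]
    [HasZeroObject C] [Protomodular C] [HasBinaryCoproducts C] (hToN : TransitivityOfNormality C)
    (B : C) : HasNormalClosures (Pt B) := by
  intro P Q x _
  obtain ⟨N, n, hn⟩ := exists_isNormalClosure ((kerFunctor B).map x)
  obtain ⟨M, m, hm, ⟨i, hi⟩, j, hj⟩ := exists_isNormalMono_kerFunctor hToN n hn.isNormalMono
  obtain ⟨a, ha⟩ := hn.le
  refine ⟨M, m, hm, hm.exists_comp_of_kerFunctor x ⟨a ≫ i, by rw [Category.assoc, hi, ha]⟩,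
    fun {K} k hk ⟨b, hb⟩ => ?_⟩
  obtain ⟨c, hc⟩ := hn.minimal _ hk.kerFunctor_map
    ⟨(kerFunctor B).map b, by rw [← Functor.map_comp, hb]⟩
  exact hk.exists_comp_of_kerFunctor m ⟨j ≫ c, by rw [Category.assoc, hc, hj]⟩

/-- Lifting Ker(f) gives a normal subpoint `m` through which `f` factors; the comparison is
bijective on kernels, so the split short five lemma makes it an isomorphism. -/
theorem stronglyProtomodular (hToN : TransitivityOfNormality C) : StronglyProtomodular C := by
  refine ⟨fun B {P Q} f hf => ?_⟩
  obtain ⟨M, m, hm, ⟨i, hi⟩, j, hj⟩ := exists_isNormalMono_kerFunctor hToN _ hf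
  have := hf.mono
  obtain ⟨hm', -⟩ := hm.exists_hom
  obtain ⟨d, hd⟩ := hm.exists_comp_of_kerFunctor f ⟨i, hi⟩
  have hd' : d.hom ≫ m.hom = f.hom := congrArg PtHom.hom hd
  have : IsIso d.hom := by
    refine Pt.isIso_hom_of_kernel d fun t ht => ?_
    obtain ⟨u, hu⟩ : ∃ u, t ≫ m.hom = u ≫ kernel.ι P.proj ≫ f.hom :=
      ⟨kernel.lift M.proj t ht ≫ j, by rw [← kerFunctor_map_ι f, Category.assoc, reassoc_of% hj,
        kerFunctor_map_ι, kernel.lift_ι_assoc]⟩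
    refine ⟨u ≫ kernel.ι P.proj, ⟨by rw [Category.assoc, kernel.condition, comp_zero], ?_⟩,
      fun c ⟨hc, hc'⟩ => ?_⟩
    · rw [← cancel_mono m.hom, hu, Category.assoc, Category.assoc, hd']
    · rw [← hc', Category.assoc, hd', ← kernel.lift_ι P.proj c hc, Category.assoc,
        ← kerFunctor_map_ι f, ← Category.assoc, ← Category.assoc, cancel_mono, cancel_mono] at hu
      rw [← hu, kernel.lift_ι]
  have := Pt.isIso_of_isIso_hom d
  exact hm.of_iso d hd

end KernelFunctor

end SemiAb

theorem mainTheorem9 {C : Type u} [Category.{v} C] [HasZeroMorphisms C] [SemiAb.SemiAbelian C]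
    (hToN : SemiAb.TransitivityOfNormality C) :
    (∀ B : C, SemiAb.HasNormalClosures (SemiAb.Pt B) ∧
      SemiAb.PreservesNormalClosures (SemiAb.kerFunctor B)) ∧
    SemiAb.StronglyProtomodular C ∧
    SemiAb.SmithIsHuq C ∧
    SemiAb.NormalityOfHigginsCommutators C :=
  ⟨fun B => ⟨SemiAb.hasNormalClosures_pt hToN B, SemiAb.kerFunctor_preservesNormalClosures hToN B⟩,
    SemiAb.stronglyProtomodular hToN, SemiAb.smithIsHuq hToN,
    SemiAb.normalityOfHigginsCommutators hToN⟩
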